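/- \textbf{Generalised Quantum Pl\"ucker Relations for Quantum Grassmannians.} Let $k$ be a field, $0\neq q\in k$, and let $1\le m\le n$ be integers. Let $\mathcal O_q(M_{mn})$ be the $k$-algebra generated by $X_{ij}$ ($1\le i\le m$, $1\le j\le n$) subject to the relations $$X_{ij}X_{il}=qX_{il}X_{ij},\qquad X_{ij}X_{rj}=qX_{rj}X_{ij},\qquad X_{il}X_{rj}=X_{rj}X_{il},\qquad X_{ij}X_{rl}-X_{rl}X_{ij}=(q-q^{-1})X_{il}X_{rj}$$ for $1\le i<r\le m$ and $1\le j<l\le n$ (the first also for every row $i$, and the second also for every column $j$). For $J=\{j_1<\dots<j_m\}\subseteq\{1,\dots,n\}$ let $$[J]=\sum_{\sigma\in S_m}(-q)^{l(\sigma)}X_{1,j_{\sigma(1)}}\cdots X_{m,j_{\sigma(m)}}$$ be the maximal quantum minor with column set $J$, where $l(\sigma)$ is the number of inversions of $\sigma$, and let $\mathcal G_q(m,n)$ be the subalgebra of $\mathcal O_q(M_{mn})$ generated by all these $[J]$. For $I,J\subseteq\{1,\dots,n\}$ put $\ell(I;J)=|\{(i,j)\in I\times J: i>j\}|$. Let $J_1,J_2,K\subseteq\{1,\dots,n\}$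 be such that $|J_1|,|J_2|\le m$ and $|K|=2m-|J_1|-|J_2|>m$. Then in $\mathcal G_q(m,n)$ $$\sum_{K'\sqcup K''=K}(-q)^{\ell(J_1;K')+\ell(K';K'')+\ell(K'';J_2)}\,[J_1\sqcup K']\,[K''\sqcup J_2]=0,$$ where the sum runs over all pairs $(K',K'')$ of disjoint sets with union $K$ such that $J_1\cap K'=\emptyset=K''\cap J_2$ and $|J_1\sqcup K'|=|K''\sqcup J_2|=m$. -/

import Mathlib

namespace QuantumGrassmannian

/-- The defining relations of the algebra of quantum `m × n` matrices, imposed on the free algebra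
on indeterminates `X (i, j)`. -/
inductive Rel {k : Type*} [Field k] (q : k) (m n : ℕ) :
    FreeAlgebra k (Fin m × Fin n) → FreeAlgebra k (Fin m × Fin n) → Prop
  | row (i : Fin m) (j l : Fin n) (hjl : j < l) :
      Rel q m n (FreeAlgebra.ι k (i, j) * FreeAlgebra.ι k (i, l))
        (q • (FreeAlgebra.ι k (i, l) * FreeAlgebra.ι k (i, j)))
  | col (i r : Fin m) (j : Fin n) (hir : i < r) :
      Rel q m n (FreeAlgebra.ι k (i, j) * FreeAlgebra.ι k (r, j))
        (q • (FreeAlgebra.ι k (r, j) * FreeAlgebra.ι k (i, j)))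
  | anti (i r : Fin m) (j l : Fin n) (hir : i < r) (hjl : j < l) :
      Rel q m n (FreeAlgebra.ι k (i, l) * FreeAlgebra.ι k (r, j))
        (FreeAlgebra.ι k (r, j) * FreeAlgebra.ι k (i, l))
  | diag (i r : Fin m) (j l : Fin n) (hir : i < r) (hjl : j < l) :
      Rel q m n
        (FreeAlgebra.ι k (i, j) * FreeAlgebra.ι k (r, l) -
          FreeAlgebra.ι k (r, l) * FreeAlgebra.ι k (i, j))
        ((q - q⁻¹) • (FreeAlgebra.ι k (i, l) * FreeAlgebra.ι k (r, j)))

/-- The coordinate ring `O_q(M_{mn})` of quantum `m × n` matrices. -/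
abbrev QuantumMatrices {k : Type*} [Field k] (q : k) (m n : ℕ) : Type _ :=
  RingQuot (Rel q m n)

/-- The canonical generator `X_{ij}` of `O_q(M_{mn})`. -/
noncomputable def X {k : Type*} [Field k] (q : k) {m n : ℕ} (i : Fin m) (j : Fin n) :
    QuantumMatrices q m n :=
  RingQuot.mkAlgHom k (Rel q m n) (FreeAlgebra.ι k (i, j))

/-- The length of a permutation: its number of inversions. -/
def permLength {s : ℕ} (σ : Equiv.Perm (Fin s)) : ℕ :=
  ((Finset.univ : Finset (Fin s × Fin s)).filter (fun p => p.1 < p.2 ∧ σ p.2 < σ p.1)).card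

/-- The quantum minor `[I | J]`: the quantum determinant
`∑_σ (-q)^{l(σ)} X_{i_1, j_{σ(1)}} ⋯ X_{i_s, j_{σ(s)}}`, where `i_1 < ⋯ < i_s` and
`j_1 < ⋯ < j_s` are the elements of `I` and `J`. -/
noncomputable def quantumMinor {k : Type*} [Field k] (q : k) {m n s : ℕ}
    (I : Finset (Fin m)) (J : Finset (Fin n)) (hI : I.card = s) (hJ : J.card = s) :
    QuantumMatrices q m n :=
  ∑ σ : Equiv.Perm (Fin s), (-q) ^ permLength σ •
    (List.ofFn fun t : Fin s => X q (I.orderEmbOfFin hI t) (J.orderEmbOfFin hJ (σ t))).prod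

/-- The maximal quantum minor on all `m` rows and the column set `J`, in `O_q(M_{mn})`. -/
noncomputable def maximalMinor {k : Type*} [Field k] (q : k) {m n : ℕ}
    (J : Finset (Fin n)) (hJ : J.card = m) : QuantumMatrices q m n :=
  quantumMinor q Finset.univ J (Finset.card_fin m) hJ

/-- The quantum grassmannian `G_q(m,n)`: the subalgebra of `O_q(M_{mn})` generated by the
`m × m` quantum minors. -/
noncomputable def Gq {k : Type*} [Field k] (q : k) (m n : ℕ) :
    Subalgebra k (QuantumMatrices q m n) :=
  Algebra.adjoin k {x | ∃ (J : Finset (Fin n)) (hJ : J.card = m), x = maximalMinor q J hJ}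

/-- The generator `[J]` of `G_q(m,n)`. -/
noncomputable def bracket {k : Type*} [Field k] (q : k) {m n : ℕ}
    (J : Finset (Fin n)) (hJ : J.card = m) : Gq q m n :=
  ⟨maximalMinor q J hJ, Algebra.subset_adjoin ⟨J, hJ, rfl⟩⟩

/-- `ℓ(I; J) = |{(i, j) ∈ I × J : i > j}|`. -/
def ell {n : ℕ} (I J : Finset (Fin n)) : ℕ :=
  ((I ×ˢ J).filter (fun p => p.2 < p.1)).card

/-- The index set of the sum: pairs `(K', K'')` with `K' ⊔ K'' = K` for which `J₁ ⊔ K'` and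
`K'' ⊔ J₂` are disjoint unions with `m` elements, so that `[J₁ ⊔ K']` and `[K'' ⊔ J₂]` make
sense. -/
abbrev Splitting {n : ℕ} (m : ℕ) (J₁ J₂ K : Finset (Fin n)) : Type :=
  {p : Finset (Fin n) × Finset (Fin n) //
    (Disjoint p.1 p.2 ∧ p.1 ∪ p.2 = K) ∧
    (Disjoint J₁ p.1 ∧ J₁.card + p.1.card = m) ∧
    (Disjoint p.2 J₂ ∧ p.2.card + J₂.card = m)}

end QuantumGrassmannian

/-!
Maximal minors are special cases of the quantum minors `[I | J]`. Defining these by expansion along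
the first row lets the rows be listed by an arbitrary word. The relations between two rows say that
exchanging two adjacent letters that are out of order costs a factor `-q`, and that a word with a
repeated letter gives zero; cutting a word in two is therefore Laplace expansion along a set of
rows. Minors are invariant under transposition, so Laplace expansion along columns is available as
well.

Expand `[J₁ ⊔ K']` along the columns `J₁ | K'` and `[K'' ⊔ J₂]` along the columns `K'' | J₂`. For
fixed row sets `R` of the first minor and `S` of the second, the sum over `K'` is the Laplace
expansion, along the columns `K`, of a minor whose rows are the complement of `R` followed by `S`.
These two sets have `m - |J₁|` and `m - |J₂|` elements, together `|K| > m`, so they share a row and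
the sum vanishes.
-/

namespace QuantumGrassmannian

open Finset Matrix

section Ell

variable {n : ℕ}

@[simp]
theorem ell_empty_left (J : Finset (Fin n)) : ell ∅ J = 0 := by
  simp [ell]

@[simp]
theorem ell_empty_right (I : Finset (Fin n)) : ell I ∅ = 0 := by
  simp [ell]

theorem ell_union_left {I I' : Finset (Fin n)} (h : Disjoint I I') (J : Finset (Fin n)) :
    ell (I ∪ I') J = ell I J + ell I' J := by
  rw [ell, union_product, filter_union,
    card_union_of_disjoint (disjoint_filter_filter (disjoint_product.2 (Or.inl h))), ell, ell]

theorem ell_union_right (I : Finset (Fin n)) {J J' : Finset (Fin n)} (h : Disjoint J J') :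
    ell I (J ∪ J') = ell I J + ell I J' := by
  rw [ell, product_union, filter_union,
    card_union_of_disjoint (disjoint_filter_filter (disjoint_product.2 (Or.inr h))), ell, ell]

theorem ell_insert_left {i : Fin n} {I : Finset (Fin n)} (hi : i ∉ I) (J : Finset (Fin n)) :
    ell (insert i I) J = ell {i} J + ell I J := by
  rw [insert_eq, ell_union_left (disjoint_singleton_left.2 hi)]

theorem ell_eq_zero {I J : Finset (Fin n)} (h : ∀ i ∈ I, ∀ j ∈ J, i ≤ j) : ell I J = 0 := by
  rw [ell, card_eq_zero, filter_eq_empty_iff]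
  rintro ⟨i, j⟩ hij
  exact (h i (mem_product.1 hij).1 j (mem_product.1 hij).2).not_gt

theorem ell_singleton_eq_zero {i : Fin n} {J : Finset (Fin n)} (h : ∀ j ∈ J, i < j) :
    ell {i} J = 0 :=
  ell_eq_zero fun _ hi j hj => mem_singleton.1 hi ▸ (h j hj).le

theorem ell_singleton_left (i : Fin n) (J : Finset (Fin n)) : ell {i} J = #{j ∈ J | j < i} := by
  rw [ell, singleton_product, filter_map, card_map]
  rfl

theorem ell_singleton_insert_of_lt {i j : Fin n} {J : Finset (Fin n)} (hji : j < i) (hj : j ∉ J) :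
    ell {i} (insert j J) = ell {i} J + 1 := by
  rw [ell_singleton_left, filter_insert, if_pos hji,
    card_insert_of_notMem fun h => hj (mem_filter.1 h).1, ell_singleton_left]

theorem ell_singleton_insert_of_gt {i j : Fin n} {J : Finset (Fin n)} (hij : i < j) :
    ell {i} (insert j J) = ell {i} J := by
  rw [ell_singleton_left, filter_insert, if_neg hij.not_gt, ell_singleton_left]

end Ell

section FinsetLemmas

variable {ι M : Type*} [AddCommMonoid M]

theorem sum_powerset_sum_mem [DecidableEq ι] (K : Finset ι) (f : Finset ι → ι → M) :
    ∑ S ∈ K.powerset, ∑ j ∈ S, f S j =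
      ∑ j ∈ K, ∑ T ∈ (K.erase j).powerset, f (insert j T) j := by
  rw [sum_comm' (t' := K) (s' := fun j => {S ∈ K.powerset | j ∈ S}) (by grind)]
  refine sum_congr rfl fun j _ => sum_nbij' (·.erase j) (insert j) ?_ ?_ ?_ ?_ ?_ <;>
    simp only [mem_filter, mem_powerset] <;> grind [insert_erase, erase_insert]

theorem sum_sum_erase [LinearOrder ι] (J : Finset ι) (f : ι → ι → M) :
    ∑ j ∈ J, ∑ l ∈ J.erase j, f j l = ∑ j ∈ J, ∑ l ∈ J with j < l, (f j l + f l j) := by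
  have split (j : ι) : ∑ l ∈ J.erase j, f j l =
      ∑ l ∈ J with j < l, f j l + ∑ l ∈ J with l < j, f j l := by
    rw [← sum_union (disjoint_filter.2 fun _ _ h => h.not_gt)]
    exact sum_congr (by grind) fun _ _ => rfl
  simp only [split, sum_add_distrib]
  congr 1
  exact sum_comm' fun j l => by simp only [mem_filter]; tauto

theorem sort_insert_of_forall_lt {α : Type*} [LinearOrder α] {a : α} {S : Finset α}
    (h : ∀ b ∈ S, a < b) : (insert a S).sort = a :: S.sort :=
  sort_insert _ (fun b hb => (h b hb).le) fun ha => (h a ha).false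

end FinsetLemmas

theorem sum_splitting {M : Type*} [AddCommMonoid M] {m n : ℕ} {J₁ J₂ K : Finset (Fin n)}
    (hK : #K + #J₁ + #J₂ = 2 * m) {f : Finset (Fin n) → Finset (Fin n) → M}
    (hf : ∀ K' K'', Disjoint J₁ K' → #J₁ + #K' ≠ m → f K' K'' = 0) :
    ∑ p : Splitting m J₁ J₂ K, f p.1.1 p.1.2 =
      ∑ K' ∈ K.powerset with Disjoint J₁ K' ∧ Disjoint (K \ K') J₂, f K' (K \ K') := by
  have sdiff_fst (p : Splitting m J₁ J₂ K) : K \ p.1.1 = p.1.2 := by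
    obtain ⟨⟨K', K''⟩, ⟨hd, rfl⟩, -⟩ := p
    exact union_sdiff_cancel_left hd
  refine sum_of_injOn (fun p => p.1.1) ?_ ?_ ?_ fun p _ => by rw [sdiff_fst]
  · intro p _ p' _ h
    have snd_eq : p.1.2 = p'.1.2 := by
      rw [← sdiff_fst p, ← sdiff_fst p']
      exact congrArg (K \ ·) h
    exact Subtype.ext (Prod.ext h snd_eq)
  · intro p _
    have subset_K : p.1.1 ⊆ K := subset_union_left.trans_eq p.2.1.2
    simpa [sdiff_fst, subset_K] using ⟨p.2.2.1.1, p.2.2.2.1⟩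
  · intro K' hK' not_fst
    obtain ⟨hsub, h₁, h₂⟩ : K' ⊆ K ∧ Disjoint J₁ K' ∧ Disjoint (K \ K') J₂ := by simpa using hK'
    refine hf K' _ h₁ fun hcard => not_fst ?_
    have := card_sdiff_add_card_eq_card hsub
    exact ⟨⟨(K', K \ K'), ⟨disjoint_sdiff, union_sdiff_of_subset hsub⟩, ⟨h₁, hcard⟩, h₂,
      by dsimp only; omega⟩, mem_coe.2 (mem_univ _), rfl⟩

section WordMinor

variable {k A ρ : Type*} [CommRing k] [Ring A] [Algebra k A] {n : ℕ}

/-- The quantum minor of the matrix `Y` on the columns `J`, whose rows are listed by a word that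
may be unsorted and have repeated letters. It is defined by iterated expansion along the first
row, and is zero unless the word has as many letters as `J` has elements. -/
def wordMinor (q : k) (Y : Matrix ρ (Fin n) A) : List ρ → Finset (Fin n) → A
  | [], J => if J = ∅ then 1 else 0
  | a :: w, J => ∑ j ∈ J, (-q) ^ ell {j} (J.erase j) • (Y a j * wordMinor q Y w (J.erase j))

variable (q : k) (Y : Matrix ρ (Fin n) A)

theorem wordMinor_nil (J : Finset (Fin n)) : wordMinor q Y [] J = if J = ∅ then 1 else 0 := rfl

theorem wordMinor_cons (a : ρ) (w : List ρ) (J : Finset (Fin n)) :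
    wordMinor q Y (a :: w) J =
      ∑ j ∈ J, (-q) ^ ell {j} (J.erase j) • (Y a j * wordMinor q Y w (J.erase j)) := rfl

variable {q Y} in
theorem wordMinor_cons_congr {w w' : List ρ} {c : k}
    (h : ∀ J, wordMinor q Y w J = c • wordMinor q Y w' J) (a : ρ) (J : Finset (Fin n)) :
    wordMinor q Y (a :: w) J = c • wordMinor q Y (a :: w') J := by
  simp only [wordMinor_cons, h, mul_smul_comm, smul_sum]
  exact sum_congr rfl fun j _ => smul_comm ..

theorem wordMinor_eq_zero_of_length_ne {w : List ρ} {J : Finset (Fin n)} (h : w.length ≠ #J) :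
    wordMinor q Y w J = 0 := by
  induction w generalizing J with
  | nil => exact if_neg fun hJ => h (by simp [hJ])
  | cons a w ih =>
    refine sum_eq_zero fun j hj => ?_
    have hw : w.length ≠ #(J.erase j) := by
      rw [List.length_cons, ← card_erase_add_one hj] at h
      omega
    rw [ih hw, mul_zero, smul_zero]

theorem wordMinor_append (v w : List ρ) (J : Finset (Fin n)) :
    wordMinor q Y (v ++ w) J =
      ∑ S ∈ J.powerset, (-q) ^ ell S (J \ S) • (wordMinor q Y v S * wordMinor q Y w (J \ S)) := by
  induction v generalizing J with
  | nil =>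
    rw [sum_eq_single_of_mem ∅ (empty_mem_powerset J)]
    · simp [wordMinor_nil]
    · intro S _ hS
      simp [wordMinor_nil, hS]
  | cons a v ih =>
    simp only [wordMinor_cons, List.cons_append, sum_mul, smul_sum]
    rw [sum_powerset_sum_mem]
    refine sum_congr rfl fun j _ => ?_
    rw [ih, mul_sum, smul_sum]
    refine sum_congr rfl fun T hT => ?_
    have hTJ : T ⊆ J.erase j := mem_powerset.1 hT
    have hjT : j ∉ T := fun h => notMem_erase j J (hTJ h)
    have sdiff_insert_eq : J \ insert j T = J.erase j \ T := by grind
    have ell_erase : ell {j} (J.erase j) = ell {j} T + ell {j} (J.erase j \ T) := by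
      rw [← ell_union_right _ disjoint_sdiff, union_sdiff_of_subset hTJ]
    rw [erase_insert hjT, sdiff_insert_eq, ell_insert_left hjT, ell_erase]
    simp only [smul_mul_assoc, mul_smul_comm, smul_smul, ← pow_add, mul_assoc]
    congr 2
    ring

theorem wordMinor_cons_cons (a b : ρ) (w : List ρ) (J : Finset (Fin n)) :
    wordMinor q Y (a :: b :: w) J = ∑ j ∈ J, ∑ l ∈ J with j < l,
      (-q) ^ (ell {j} ((J.erase j).erase l) + ell {l} ((J.erase j).erase l)) •
        ((Y a j * Y b l + (-q) • (Y a l * Y b j)) * wordMinor q Y w ((J.erase j).erase l)) := by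
  simp only [wordMinor_cons, mul_sum, smul_sum]
  rw [sum_sum_erase]
  refine sum_congr rfl fun j hj => sum_congr rfl fun l hl => ?_
  obtain ⟨hl, hjl⟩ := mem_filter.1 hl
  rw [erase_right_comm (a := l) (b := j)]
  set R := (J.erase j).erase l
  have erase_j : J.erase j = insert l R := by grind
  have erase_l : J.erase l = insert j R := by grind
  rw [erase_j, erase_l, ell_singleton_insert_of_gt hjl,
    ell_singleton_insert_of_lt hjl (by grind)]
  simp only [mul_smul_comm, smul_mul_assoc, smul_smul, add_mul, smul_add, ← mul_assoc]
  congr 2 <;> ring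

end WordMinor

section Minor

variable {k A : Type*} [CommRing k] [Ring A] [Algebra k A] {m n : ℕ}

/-- The quantum minor `[I | J]` of the matrix `Y`, for an arbitrary pair of index sets; it is zero
if their cardinalities differ. -/
def minor (q : k) (Y : Matrix (Fin m) (Fin n) A) (I : Finset (Fin m)) (J : Finset (Fin n)) : A :=
  wordMinor q Y I.sort J

variable (q : k) (Y : Matrix (Fin m) (Fin n) A)

theorem minor_eq_zero_of_card_ne {I : Finset (Fin m)} {J : Finset (Fin n)} (h : #I ≠ #J) :
    minor q Y I J = 0 :=
  wordMinor_eq_zero_of_length_ne q Y (by rwa [length_sort])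

theorem minor_empty_left (J : Finset (Fin n)) : minor q Y ∅ J = if J = ∅ then 1 else 0 := by
  rw [minor, sort_empty, wordMinor_nil]

theorem minor_empty_right (I : Finset (Fin m)) : minor q Y I ∅ = if I = ∅ then 1 else 0 := by
  split_ifs with hI
  · rw [hI, minor_empty_left, if_pos rfl]
  · exact minor_eq_zero_of_card_ne q Y (by simpa using hI)

theorem minor_insert_left {i : Fin m} {I : Finset (Fin m)} (hi : ∀ r ∈ I, i < r)
    (J : Finset (Fin n)) :
    minor q Y (insert i I) J =
      ∑ j ∈ J, (-q) ^ ell {j} (J.erase j) • (Y i j * minor q Y I (J.erase j)) := by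
  rw [minor, sort_insert_of_forall_lt hi, wordMinor_cons]
  rfl

end Minor

/-- The entries of `Y` satisfy the defining relations of quantum matrices. The parameter is a unit,
so that any commutative base ring is allowed. -/
structure IsQuantumMatrix {k A : Type*} [CommRing k] [Ring A] [Algebra k A] {m n : ℕ} (q : kˣ)
    (Y : Matrix (Fin m) (Fin n) A) : Prop where
  row (i : Fin m) (j l : Fin n) : j < l → Y i j * Y i l = (q : k) • (Y i l * Y i j)
  col (i r : Fin m) (j : Fin n) : i < r → Y i j * Y r j = (q : k) • (Y r j * Y i j)
  anti (i r : Fin m) (j l : Fin n) : i < r → j < l → Y i l * Y r j = Y r j * Y i l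
  diag (i r : Fin m) (j l : Fin n) : i < r → j < l →
    Y i j * Y r l - Y r l * Y i j = (q - q⁻¹ : k) • (Y i l * Y r j)

namespace IsQuantumMatrix

variable {k A : Type*} [CommRing k] [Ring A] [Algebra k A] {m n : ℕ} {q : kˣ}
  {Y : Matrix (Fin m) (Fin n) A}

theorem transpose (h : IsQuantumMatrix q Y) : IsQuantumMatrix q Yᵀ where
  row i j l hjl := h.col j l i hjl
  col i r j hir := h.row j i r hir
  anti i r j l hir hjl := (h.anti j l i r hjl hir).symm
  diag i r j l hir hjl := by
    simp only [transpose_apply]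
    rw [h.diag j l i r hjl hir, h.anti j l i r hjl hir]

theorem wordMinor_cons_cons_self (h : IsQuantumMatrix q Y) (i : Fin m) (w : List (Fin m))
    (J : Finset (Fin n)) : wordMinor (q : k) Y (i :: i :: w) J = 0 := by
  rw [wordMinor_cons_cons]
  refine sum_eq_zero fun j _ => sum_eq_zero fun l hl => ?_
  rw [h.row i j l (mem_filter.1 hl).2, neg_smul, add_neg_cancel, zero_mul, smul_zero]

theorem two_by_two_swap (h : IsQuantumMatrix q Y) {i r : Fin m} (hir : i < r) {j l : Fin n}
    (hjl : j < l) :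
    Y r j * Y i l + (-q : k) • (Y r l * Y i j) =
      (-q : k) • (Y i j * Y r l + (-q : k) • (Y i l * Y r j)) := by
  have coeff : -(q : k) * (q - ↑q⁻¹) = 1 - q * q := by linear_combination q.mul_inv
  rw [← h.anti i r j l hir hjl, sub_eq_iff_eq_add.1 (h.diag i r j l hir hjl)]
  simp only [smul_add, smul_smul, coeff]
  module

theorem wordMinor_swap (h : IsQuantumMatrix q Y) {i r : Fin m} (hir : i < r) (w : List (Fin m))
    (J : Finset (Fin n)) :
    wordMinor (q : k) Y (r :: i :: w) J = (-q : k) • wordMinor (q : k) Y (i :: r :: w) J := by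
  simp only [wordMinor_cons_cons, smul_sum]
  refine sum_congr rfl fun j _ => sum_congr rfl fun l hl => ?_
  rw [h.two_by_two_swap hir (mem_filter.1 hl).2, smul_mul_assoc, smul_comm]

theorem wordMinor_cons_sort_of_mem (h : IsQuantumMatrix q Y) {i : Fin m} {I : Finset (Fin m)}
    (hi : i ∈ I) (J : Finset (Fin n)) : wordMinor (q : k) Y (i :: I.sort) J = 0 := by
  induction I using Finset.induction_on_min generalizing J with
  | empty => exact absurd hi (notMem_empty i)
  | insert r I hr ih =>
    rw [sort_insert_of_forall_lt hr]
    obtain rfl | hiI := mem_insert.1 hi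
    · exact h.wordMinor_cons_cons_self i _ J
    · have ih_smul (J') : wordMinor (q : k) Y (i :: I.sort) J' =
          (0 : k) • wordMinor (q : k) Y [] J' := by rw [ih hiI, zero_smul]
      rw [h.wordMinor_swap (hr i hiI), wordMinor_cons_congr ih_smul, zero_smul, smul_zero]

theorem wordMinor_cons_sort_of_notMem (h : IsQuantumMatrix q Y) {i : Fin m} {I : Finset (Fin m)}
    (hi : i ∉ I) (J : Finset (Fin n)) :
    wordMinor (q : k) Y (i :: I.sort) J =
      (-q : k) ^ ell {i} I • minor (q : k) Y (insert i I) J := by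
  induction I using Finset.induction_on_min generalizing J with
  | empty => simp [minor]
  | insert r I hr ih =>
    obtain ⟨hne, hiI⟩ : i ≠ r ∧ i ∉ I := by simpa using hi
    obtain hir | hri := hne.lt_or_gt
    · have i_lt : ∀ b ∈ insert r I, i < b :=
        forall_mem_insert .. |>.2 ⟨hir, fun b hb => hir.trans (hr b hb)⟩
      rw [ell_singleton_eq_zero i_lt, pow_zero, one_smul, minor, sort_insert_of_forall_lt i_lt]
    · have r_lt : ∀ b ∈ insert i I, r < b := forall_mem_insert .. |>.2 ⟨hri, hr⟩
      rw [sort_insert_of_forall_lt hr, h.wordMinor_swap hri, wordMinor_cons_congr (ih hiI),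
        ell_singleton_insert_of_lt hri fun hrI => (hr r hrI).false, pow_succ', mul_smul, minor,
        insert_comm, sort_insert_of_forall_lt r_lt]

theorem wordMinor_sort_append_sort_of_disjoint (h : IsQuantumMatrix q Y) {S T : Finset (Fin m)}
    (hST : Disjoint S T) (J : Finset (Fin n)) :
    wordMinor (q : k) Y (S.sort ++ T.sort) J =
      (-q : k) ^ ell S T • minor (q : k) Y (S ∪ T) J := by
  induction S using Finset.induction_on_min generalizing J with
  | empty => simp [minor]
  | insert i S hi ih =>
    obtain ⟨hiT, hST⟩ := disjoint_insert_left.1 hST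
    have hiS : i ∉ S := fun hiS => (hi i hiS).false
    have ell_union : ell {i} (S ∪ T) = ell {i} T := by
      rw [ell_union_right _ hST, ell_singleton_eq_zero hi, zero_add]
    rw [sort_insert_of_forall_lt hi, List.cons_append, wordMinor_cons_congr (ih hST),
      h.wordMinor_cons_sort_of_notMem (by simp [hiS, hiT]), smul_smul, ← pow_add, ell_union,
      ell_insert_left hiS, insert_union, add_comm]

theorem wordMinor_sort_append_sort_of_not_disjoint (h : IsQuantumMatrix q Y)
    {S T : Finset (Fin m)} (hST : ¬Disjoint S T) (J : Finset (Fin n)) :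
    wordMinor (q : k) Y (S.sort ++ T.sort) J = 0 := by
  induction S using Finset.induction_on_min generalizing J with
  | empty => exact absurd (disjoint_empty_left T) hST
  | insert i S hi ih =>
    rw [sort_insert_of_forall_lt hi, List.cons_append]
    by_cases hd : Disjoint S T
    · have hiT : i ∈ T := by
        by_contra hiT
        exact hST (disjoint_insert_left.2 ⟨hiT, hd⟩)
      rw [wordMinor_cons_congr (h.wordMinor_sort_append_sort_of_disjoint hd),
        h.wordMinor_cons_sort_of_mem (mem_union_right S hiT), smul_zero]
    · have ih_smul (J') : wordMinor (q : k) Y (S.sort ++ T.sort) J' =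
          (0 : k) • wordMinor (q : k) Y [] J' := by rw [ih hd, zero_smul]
      rw [wordMinor_cons_congr ih_smul, zero_smul]

/-- Expanding both sides along the first row and then along the first column yields the same
double sum, because the entries `Y i j'` and `Y i' j` on an antidiagonal commute. -/
theorem minor_insert_right (h : IsQuantumMatrix q Y) {j : Fin n} {J : Finset (Fin n)}
    (hj : ∀ l ∈ J, j < l) (I : Finset (Fin m)) :
    minor (q : k) Y I (insert j J) =
      ∑ i ∈ I, (-q : k) ^ ell {i} (I.erase i) • (Y i j * minor (q : k) Y (I.erase i) J) := by
  induction I using Finset.induction_on_min generalizing J with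
  | empty => simp [minor_empty_left]
  | insert i I hi ih =>
    have hiI : i ∉ I := fun hiI => (hi i hiI).false
    have hjJ : j ∉ J := fun hjJ => (hj j hjJ).false
    rw [minor_insert_left _ _ hi, sum_insert hjJ, sum_insert hiI, erase_insert hjJ,
      erase_insert hiI, ell_singleton_eq_zero hj, ell_singleton_eq_zero hi]
    congr 1
    have expand_col : ∀ l ∈ J, (-q : k) ^ ell {l} ((insert j J).erase l) •
        (Y i l * minor (q : k) Y I ((insert j J).erase l)) =
        ∑ r ∈ I, (-q : k) ^ (ell {l} (J.erase l) + 1 + ell {r} (I.erase r)) •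
          (Y i l * Y r j * minor (q : k) Y (I.erase r) (J.erase l)) := fun l hl => by
      rw [erase_insert_of_ne (hj l hl).ne, ih fun b hb => hj b (mem_of_mem_erase hb),
        ell_singleton_insert_of_lt (hj l hl) fun h => hjJ (mem_of_mem_erase h)]
      simp only [mul_sum, smul_sum, mul_smul_comm, smul_smul, ← pow_add, mul_assoc]
    have expand_row : ∀ r ∈ I, (-q : k) ^ ell {r} ((insert i I).erase r) •
        (Y r j * minor (q : k) Y ((insert i I).erase r) J) =
        ∑ l ∈ J, (-q : k) ^ (ell {r} (I.erase r) + 1 + ell {l} (J.erase l)) •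
          (Y r j * Y i l * minor (q : k) Y (I.erase r) (J.erase l)) := fun r hr => by
      rw [erase_insert_of_ne (hi r hr).ne,
        minor_insert_left _ _ fun b hb => hi b (mem_of_mem_erase hb),
        ell_singleton_insert_of_lt (hi r hr) fun h => hiI (mem_of_mem_erase h)]
      simp only [mul_sum, smul_sum, mul_smul_comm, smul_smul, ← pow_add, mul_assoc]
    rw [sum_congr rfl expand_col, sum_congr rfl expand_row, sum_comm]
    refine sum_congr rfl fun r hr => sum_congr rfl fun l hl => ?_
    rw [h.anti i r j l (hi r hr) (hj l hl), add_right_comm, add_comm (ell {l} _), add_right_comm]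

theorem minor_transpose (h : IsQuantumMatrix q Y) (I : Finset (Fin m)) (J : Finset (Fin n)) :
    minor (q : k) Yᵀ J I = minor (q : k) Y I J := by
  induction J using Finset.induction_on_min generalizing I with
  | empty => rw [minor_empty_left, minor_empty_right]
  | insert j J hj ih =>
    simp only [minor_insert_left _ _ hj, h.minor_insert_right hj, ih, transpose_apply]

theorem laplace_rows (h : IsQuantumMatrix q Y) {S T : Finset (Fin m)} (hST : Disjoint S T)
    (J : Finset (Fin n)) :
    ∑ J' ∈ J.powerset, (-q : k) ^ ell J' (J \ J') •
        (minor (q : k) Y S J' * minor (q : k) Y T (J \ J')) =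
      (-q : k) ^ ell S T • minor (q : k) Y (S ∪ T) J := by
  rw [← h.wordMinor_sort_append_sort_of_disjoint hST, wordMinor_append]
  rfl

theorem laplace_rows_of_not_disjoint (h : IsQuantumMatrix q Y) {S T : Finset (Fin m)}
    (hST : ¬Disjoint S T) (J : Finset (Fin n)) :
    ∑ J' ∈ J.powerset, (-q : k) ^ ell J' (J \ J') •
      (minor (q : k) Y S J' * minor (q : k) Y T (J \ J')) = 0 := by
  rw [← h.wordMinor_sort_append_sort_of_not_disjoint hST J, wordMinor_append]
  rfl

theorem laplace_cols (h : IsQuantumMatrix q Y) {J L : Finset (Fin n)} (hJL : Disjoint J L)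
    (I : Finset (Fin m)) :
    ∑ R ∈ I.powerset, (-q : k) ^ ell R (I \ R) •
        (minor (q : k) Y R J * minor (q : k) Y (I \ R) L) =
      (-q : k) ^ ell J L • minor (q : k) Y I (J ∪ L) := by
  simpa only [h.minor_transpose] using h.transpose.laplace_rows hJL I

theorem laplace_cols_of_not_disjoint (h : IsQuantumMatrix q Y) {J L : Finset (Fin n)}
    (hJL : ¬Disjoint J L) (I : Finset (Fin m)) :
    ∑ R ∈ I.powerset, (-q : k) ^ ell R (I \ R) •
      (minor (q : k) Y R J * minor (q : k) Y (I \ R) L) = 0 := by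
  simpa only [h.minor_transpose] using h.transpose.laplace_rows_of_not_disjoint hJL I

/-- Unless both outer minors are square, the summand vanishes; if they are, the row sets `I \ R`
and `S` are too large to be disjoint, and the inner sum is a Laplace expansion with a repeated
row. -/
theorem minor_mul_sum_mul_minor_eq_zero (h : IsQuantumMatrix q Y) {I : Finset (Fin m)}
    {J₁ J₂ : Finset (Fin n)} (hI : #J₁ + #J₂ < #I) (K : Finset (Fin n)) (R S : Finset (Fin m)) :
    minor (q : k) Y R J₁ *
      (∑ K' ∈ K.powerset, (-q : k) ^ ell K' (K \ K') •
        (minor (q : k) Y (I \ R) K' * minor (q : k) Y S (K \ K'))) *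
      minor (q : k) Y (I \ S) J₂ = 0 := by
  by_cases hR : #R = #J₁
  · by_cases hS : #(I \ S) = #J₂
    · have not_disjoint : ¬Disjoint (I \ R) S := fun hd => by
        have := card_le_card (subset_sdiff.2 ⟨sdiff_subset, hd⟩)
        have := le_card_sdiff R I
        omega
      rw [h.laplace_rows_of_not_disjoint not_disjoint, mul_zero, zero_mul]
    · rw [minor_eq_zero_of_card_ne _ _ hS, mul_zero]
  · rw [minor_eq_zero_of_card_ne _ _ hR, zero_mul, zero_mul]

theorem pluecker (h : IsQuantumMatrix q Y) {I : Finset (Fin m)} {J₁ J₂ : Finset (Fin n)}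
    (hI : #J₁ + #J₂ < #I) (K : Finset (Fin n)) :
    ∑ K' ∈ K.powerset with Disjoint J₁ K' ∧ Disjoint (K \ K') J₂,
      (-q : k) ^ (ell J₁ K' + ell K' (K \ K') + ell (K \ K') J₂) •
        (minor (q : k) Y I (J₁ ∪ K') * minor (q : k) Y I (K \ K' ∪ J₂)) = 0 := by
  let F (K' : Finset (Fin n)) : A :=
    ∑ R ∈ I.powerset, (-q : k) ^ ell R (I \ R) •
      (minor (q : k) Y R J₁ * minor (q : k) Y (I \ R) K')
  let G (K'' : Finset (Fin n)) : A :=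
    ∑ S ∈ I.powerset, (-q : k) ^ ell S (I \ S) •
      (minor (q : k) Y S K'' * minor (q : k) Y (I \ S) J₂)
  calc
    _ = ∑ K' ∈ K.powerset, (-q : k) ^ ell K' (K \ K') • (F K' * G (K \ K')) := by
      rw [sum_filter]
      refine sum_congr rfl fun K' _ => ?_
      split_ifs with hd
      · simp only [F, G, h.laplace_cols hd.1, h.laplace_cols hd.2, smul_mul_smul_comm, smul_smul,
          ← pow_add]
        congr 2
        ring
      · obtain hd | hd := not_and_or.1 hd
        · simp only [F, h.laplace_cols_of_not_disjoint hd, zero_mul, smul_zero]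
        · simp only [G, h.laplace_cols_of_not_disjoint hd, mul_zero, smul_zero]
    _ = ∑ R ∈ I.powerset, ∑ S ∈ I.powerset, ((-q : k) ^ ell R (I \ R) * (-q) ^ ell S (I \ S)) •
          (minor (q : k) Y R J₁ *
            (∑ K' ∈ K.powerset, (-q : k) ^ ell K' (K \ K') •
              (minor (q : k) Y (I \ R) K' * minor (q : k) Y S (K \ K'))) *
            minor (q : k) Y (I \ S) J₂) := by
      simp only [F, G, sum_mul_sum]
      simp only [mul_sum, sum_mul, smul_sum]
      rw [sum_comm]
      refine sum_congr rfl fun R _ => ?_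
      rw [sum_comm]
      refine sum_congr rfl fun S _ => sum_congr rfl fun K' _ => ?_
      simp only [smul_mul_assoc, mul_smul_comm, smul_smul, mul_assoc]
      congr 1
      ring
    _ = 0 := by simp only [h.minor_mul_sum_mul_minor_eq_zero hI, smul_zero, sum_const_zero]

end IsQuantumMatrix

section Arrangements

/-- The words of length `s` that list every element of `J` exactly once. -/
def arrangements {n : ℕ} (s : ℕ) (J : Finset (Fin n)) : Finset (Fin s → Fin n) :=
  {w | w.Injective ∧ univ.image w = J}

/-- The number of inversions of a word; see `permLength` for permutations. -/
def inversions {α : Type*} [LinearOrder α] {s : ℕ} (w : Fin s → α) : ℕ :=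
  #{p : Fin s × Fin s | p.1 < p.2 ∧ w p.2 < w p.1}

variable {n s : ℕ} {J : Finset (Fin n)} {M : Type*} [AddCommMonoid M]

theorem mem_arrangements {w : Fin s → Fin n} :
    w ∈ arrangements s J ↔ w.Injective ∧ univ.image w = J := by
  simp [arrangements]

theorem arrangements_zero :
    arrangements 0 J = if J = ∅ then {Fin.elim0} else ∅ := by
  ext w
  rw [mem_arrangements, univ_eq_empty, image_empty]
  split_ifs with hJ
  · simp [hJ, Function.injective_of_subsingleton, Subsingleton.elim w Fin.elim0]
  · simp [Ne.symm hJ]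

theorem cons_mem_arrangements {j : Fin n} {w : Fin s → Fin n} :
    (Fin.cons j w : Fin (s + 1) → Fin n) ∈ arrangements (s + 1) J ↔
      j ∈ J ∧ w ∈ arrangements s (J.erase j) := by
  have image_cons : univ.image (Fin.cons j w : Fin (s + 1) → Fin n) = insert j (univ.image w) := by
    ext l
    simp [Fin.exists_fin_succ, eq_comm]
  have mem_range : j ∈ Set.range w ↔ j ∈ univ.image w := by simp
  rw [mem_arrangements, mem_arrangements, Fin.cons_injective_iff, image_cons, mem_range]
  grind

theorem sum_arrangements_succ (f : (Fin (s + 1) → Fin n) → M) :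
    ∑ w ∈ arrangements (s + 1) J, f w =
      ∑ j ∈ J, ∑ w ∈ arrangements s (J.erase j), f (Fin.cons j w) := by
  rw [sum_sigma']
  refine sum_bij' (fun w _ => ⟨w 0, Fin.tail w⟩) (fun p _ => Fin.cons p.1 p.2) ?_ ?_ ?_ ?_ ?_ <;>
    intros <;> simp_all [← cons_mem_arrangements]

theorem sum_arrangements_eq_sum_perm (hJ : #J = s) (f : (Fin s → Fin n) → M) :
    ∑ w ∈ arrangements s J, f w =
      ∑ σ : Equiv.Perm (Fin s), f (fun t => J.orderEmbOfFin hJ (σ t)) := by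
  symm
  refine sum_bij (fun σ _ t => J.orderEmbOfFin hJ (σ t)) ?_ ?_ ?_ fun _ _ => rfl
  · intro σ _
    refine mem_arrangements.2 ⟨(J.orderEmbOfFin hJ).injective.comp σ.injective, ?_⟩
    change univ.image (J.orderEmbOfFin hJ ∘ σ) = J
    rw [← image_image, image_univ_equiv, image_orderEmbOfFin_univ]
  · intro σ _ τ _ h
    exact Equiv.ext fun t => (J.orderEmbOfFin hJ).injective (congrFun h t)
  · intro w hw
    obtain ⟨hw, him⟩ := mem_arrangements.1 hw
    have mem_J (t : Fin s) : w t ∈ J := him ▸ mem_image_of_mem w (mem_univ t)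
    let u (t : Fin s) : Fin s := (J.orderIsoOfFin hJ).symm ⟨w t, mem_J t⟩
    have u_injective : u.Injective := fun t t' h => hw <| by simpa [u] using h
    exact ⟨Equiv.ofBijective u (Finite.injective_iff_bijective.1 u_injective), mem_univ _,
      funext fun t => by simp [u, ← coe_orderIsoOfFin_apply]⟩

theorem permLength_eq_inversions (e : Fin s ↪o Fin n) (σ : Equiv.Perm (Fin s)) :
    permLength σ = inversions fun t => e (σ t) := by
  simp only [permLength, inversions, e.lt_iff_lt]

theorem inversions_cons {j : Fin n} {w : Fin s → Fin n} (hw : w ∈ arrangements s J) :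
    inversions (Fin.cons j w : Fin (s + 1) → Fin n) = ell {j} J + inversions w := by
  obtain ⟨w_injective, rfl⟩ := mem_arrangements.1 hw
  have card_fiber : ell {j} (univ.image w) = ∑ t, if w t < j then 1 else 0 := by
    rw [ell_singleton_left, filter_image, card_image_of_injective _ w_injective, card_filter]
  simp only [card_fiber, inversions, card_filter, ← univ_product_univ, sum_product,
    Fin.sum_univ_succ]
  simp

end Arrangements

section QuantumMinor

variable {k A ρ : Type*} [CommRing k] [Ring A] [Algebra k A] {n s : ℕ}

theorem wordMinor_ofFn (q : k) (Y : Matrix ρ (Fin n) A) (a : Fin s → ρ) (J : Finset (Fin n)) :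
    wordMinor q Y (List.ofFn a) J =
      ∑ w ∈ arrangements s J, (-q) ^ inversions w • (List.ofFn fun t => Y (a t) (w t)).prod := by
  induction s generalizing J with
  | zero =>
    rw [List.ofFn_zero, wordMinor_nil, arrangements_zero]
    split_ifs <;> simp [inversions]
  | succ s ih =>
    simp only [List.ofFn_succ, wordMinor_cons, ih, mul_sum, smul_sum, sum_arrangements_succ]
    refine sum_congr rfl fun j _ => sum_congr rfl fun w hw => ?_
    simp only [inversions_cons hw, pow_add, mul_smul, mul_smul_comm, List.prod_cons, Fin.cons_zero,
      Fin.cons_succ]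

end QuantumMinor

section Generators

variable {k : Type*} [Field k] {m n : ℕ}

/-- The matrix of the canonical generators of `O_q(M_{mn})`. -/
noncomputable def generators (q : k) (m n : ℕ) : Matrix (Fin m) (Fin n) (QuantumMatrices q m n) :=
  Matrix.of (X q)

theorem isQuantumMatrix_generators {q : k} (hq : q ≠ 0) (m n : ℕ) :
    IsQuantumMatrix (Units.mk0 q hq) (generators q m n) where
  row i j l h := by
    simpa [generators, X] using RingQuot.mkAlgHom_rel k (Rel.row (q := q) i j l h)
  col i r j h := by
    simpa [generators, X] using RingQuot.mkAlgHom_rel k (Rel.col (q := q) i r j h)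
  anti i r j l h h' := by
    simpa [generators, X] using RingQuot.mkAlgHom_rel k (Rel.anti (q := q) i r j l h h')
  diag i r j l h h' := by
    simpa [generators, X] using RingQuot.mkAlgHom_rel k (Rel.diag (q := q) i r j l h h')

theorem quantumMinor_eq_minor (q : k) {s : ℕ} (I : Finset (Fin m)) (J : Finset (Fin n))
    (hI : #I = s) (hJ : #J = s) : quantumMinor q I J hI hJ = minor q (generators q m n) I J := by
  rw [minor, ← listMap_orderEmbOfFin_finRange I hI, ← List.ofFn_eq_map, wordMinor_ofFn,
    sum_arrangements_eq_sum_perm hJ, quantumMinor]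
  simp only [permLength_eq_inversions (J.orderEmbOfFin hJ), generators, of_apply]

theorem coe_bracket (q : k) (J : Finset (Fin n)) (hJ : #J = m) :
    (bracket q J hJ : QuantumMatrices q m n) = minor q (generators q m n) univ J :=
  quantumMinor_eq_minor q univ J (card_fin m) hJ

end Generators

end QuantumGrassmannian

open Finset QuantumGrassmannian in
theorem mainTheorem9_general {k A : Type*} [CommRing k] [Ring A] [Algebra k A] {m n s : ℕ} {q : kˣ}
    {Y : Matrix (Fin m) (Fin n) A} (h : IsQuantumMatrix q Y) {I : Finset (Fin m)} (hI : #I = s)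
    {J₁ J₂ K : Finset (Fin n)} (hK : (#K : ℤ) = 2 * (s : ℤ) - #J₁ - #J₂) (hKs : s < #K) :
    ∑ p : Splitting s J₁ J₂ K,
      (-q : k) ^ (ell J₁ p.1.1 + ell p.1.1 p.1.2 + ell p.1.2 J₂) •
        (minor (q : k) Y I (J₁ ∪ p.1.1) * minor (q : k) Y I (p.1.2 ∪ J₂)) = 0 := by
  let term (K' K'' : Finset (Fin n)) : A :=
    (-q : k) ^ (ell J₁ K' + ell K' K'' + ell K'' J₂) •
      (minor (q : k) Y I (J₁ ∪ K') * minor (q : k) Y I (K'' ∪ J₂))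
  have term_eq_zero (K' K'' : Finset (Fin n)) (hd : Disjoint J₁ K') (hcard : #J₁ + #K' ≠ s) :
      term K' K'' = 0 := by
    have not_square : #I ≠ #(J₁ ∪ K') := by
      rw [hI, card_union_of_disjoint hd]
      exact hcard.symm
    simp only [term, minor_eq_zero_of_card_ne _ _ not_square, zero_mul, smul_zero]
  exact (sum_splitting (by omega) term_eq_zero).trans (h.pluecker (by omega) K)

theorem mainTheorem9 {k : Type*} [Field k] (q : k) (hq : q ≠ 0) (m n : ℕ) (hm : 0 < m)
    (hmn : m ≤ n) (J₁ J₂ K : Finset (Fin n)) (hJ₁ : J₁.card ≤ m) (hJ₂ : J₂.card ≤ m)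
    (hK : (K.card : ℤ) = 2 * (m : ℤ) - J₁.card - J₂.card) (hKm : m < K.card) :
    ∑ p : QuantumGrassmannian.Splitting m J₁ J₂ K,
      (-q) ^ (QuantumGrassmannian.ell J₁ p.1.1 + QuantumGrassmannian.ell p.1.1 p.1.2 +
          QuantumGrassmannian.ell p.1.2 J₂) •
        (QuantumGrassmannian.bracket q (J₁.disjUnion p.1.1 p.2.2.1.1)
            ((Finset.card_disjUnion _ _ _).trans p.2.2.1.2) *
          QuantumGrassmannian.bracket q (p.1.2.disjUnion J₂ p.2.2.2.1)
            ((Finset.card_disjUnion _ _ _).trans p.2.2.2.2)) =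
      (0 : QuantumGrassmannian.Gq q m n) := by
  apply Subtype.ext
  simpa [QuantumGrassmannian.coe_bracket] using mainTheorem9_general
    (QuantumGrassmannian.isQuantumMatrix_generators hq m n) (Finset.card_fin m) hK hKm
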